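/- Let $\Bbbk$ be a field, $n\ge 1$, $R=\Bbbk[x_1,\dots,x_n]$ and $\mathfrak m=(x_1,\dots,x_n)$. A graded family $\mathcal I=\{I_k\}_{k\ge 0}$ consists of ideals of $R$ with $I_0=R$ and $I_pI_q\subseteq I_{p+q}$ for all $p,q\ge 0$. Its Rees algebra is $\mathcal R(\mathcal I)=\bigoplus_{k\ge 0}I_kt^k\subseteq R[t]$, and its analytic spread is the Krull dimension $\ell(\mathcal I)=\dim\big(\mathcal R(\mathcal I)/\mathfrak m\mathcal R(\mathcal I)\big)$. For an ideal $J\subseteq R$ put $\ell(J)=\ell(\{J^k\}_{k\ge 0})$. Let $\mathcal I$ be a graded family of homogeneous ideals of $R$. For an integer $a\ge 1$, the $a$-th truncation $\mathcal I_a=\{I_{a,k}\}_{k\ge0}$ is the graded family with $I_{a,k}=I_k$ for $k\le a$ and $I_{a,k}=\sum_{i,j>0,\ i+j=k}I_{a,i}I_{a,j}$ for $k>a$. There is an integer $e_a\ge 1$ such that the Veronese subalgebra $\bigoplus_{r\ge 0}I_{a,re_a}t^{re_a}$ of $\mathcal R(\mathcal I_a)$ is standard graded, that is, generated as an $R$-algebra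 by $I_{a,e_a}t^{e_a}$ (then $\mathcal R(\mathcal I_a)$ is automatically a finite module over it). For each $a\ge 1$ fix any such $e_a$. The $a$-th upper truncation $\mathcal I_a^*=\{I_{a,k}^*\}_{k\ge 0}$ is the graded family with $$I_{a,k}^*=\begin{cases} I_k & \text{if } k\le a,\\ (I_{e_a})^r & \text{if } k>a \text{ and } k=re_a \text{ with } r\in\mathbb N,\\ \sum_{i,j>0,\ i+j=k} I_{a,i}^*I_{a,j}^* & \text{otherwise.}\end{cases}$$ Then both maxima below exist, and $$\ell(\mathcal I)\le\max\{\ell(\mathcal I_a^*)\mid a\ge 1\}=\max\{\ell(I_{e_a})\mid a\ge 1\}.$$ In particular $\ell(\mathcal I)\le\dim R$, so $\ell(\mathcal I)$ is a finite non-negative integer. -/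

import Mathlib

/-- A graded family `{I_k}_{k ≥ 0}` of ideals of a commutative ring `R`: one has
`I_p * I_q ⊆ I_{p+q}` for all `p, q`, and `I_0 = R` (so that `⨁_k I_k t^k` is an `R`-subalgebra
of `R[t]`). -/
structure GradedFamily (R : Type*) [CommRing R] where
  /-- the `k`-th ideal of the family -/
  ideal : ℕ → Ideal R
  ideal_zero : ideal 0 = ⊤
  ideal_mul_le : ∀ p q : ℕ, ideal p * ideal q ≤ ideal (p + q)

namespace GradedFamily

open Polynomial

variable {R : Type*} [CommRing R]

/-- The family of ordinary powers of an ideal. -/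
def powers (J : Ideal R) : GradedFamily R where
  ideal k := J ^ k
  ideal_zero := by simp
  ideal_mul_le p q := (pow_add J p q).ge

/-- The Rees algebra `⨁_{k ≥ 0} I_k t^k ⊆ R[t]` of a graded family of ideals. -/
def reesAlg (I : GradedFamily R) : Subalgebra R R[X] where
  carrier := {f | ∀ i, f.coeff i ∈ I.ideal i}
  mul_mem' hf hg i := by
    rw [coeff_mul]
    refine Ideal.sum_mem _ ?_
    rintro ⟨j, k⟩ h
    rw [← Finset.HasAntidiagonal.mem_antidiagonal.mp h]
    exact I.ideal_mul_le j k (Ideal.mul_mem_mul (hf j) (hg k))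
  add_mem' hf hg i := by
    rw [coeff_add]
    exact Ideal.add_mem _ (hf i) (hg i)
  algebraMap_mem' r i := by
    rw [Polynomial.algebraMap_apply, coeff_C]
    split_ifs with h
    · subst h
      simp [I.ideal_zero]
    · simp

/-- The `e`-th Veronese subalgebra `⨁_{k ≥ 0} I_{ke} t^{ke}` of the Rees algebra. -/
def veronese (I : GradedFamily R) (e : ℕ) : Subalgebra R R[X] where
  carrier := {f | f ∈ I.reesAlg ∧ ∀ i, ¬ e ∣ i → f.coeff i = 0}
  mul_mem' hf hg := by
    refine ⟨mul_mem hf.1 hg.1, fun i hi => ?_⟩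
    rw [coeff_mul]
    refine Finset.sum_eq_zero ?_
    rintro ⟨j, k⟩ h
    rw [← Finset.HasAntidiagonal.mem_antidiagonal.mp h] at hi
    by_cases hj : e ∣ j
    · have hk : ¬ e ∣ k := fun hk => hi (dvd_add hj hk)
      simp [hg.2 k hk]
    · simp [hf.2 j hj]
  add_mem' hf hg := by
    refine ⟨add_mem hf.1 hg.1, fun i hi => ?_⟩
    rw [coeff_add, hf.2 i hi, hg.2 i hi, add_zero]
  algebraMap_mem' r := by
    refine ⟨I.reesAlg.algebraMap_mem r, fun i hi => ?_⟩
    have h0 : i ≠ 0 := fun h => hi (h ▸ dvd_zero e)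
    rw [Polynomial.algebraMap_apply, coeff_C, if_neg h0]

/-- The `e`-th Veronese subalgebra of the Rees algebra is standard graded: it is generated as an
`R`-algebra by its component of degree one, which is `I_e t^e`. -/
def VeroneseIsStandard (I : GradedFamily R) (e : ℕ) : Prop :=
  Algebra.adjoin R {f : R[X] | ∃ x ∈ I.ideal e, f = monomial e x} = I.veronese e

/-- The analytic spread `dim (𝓡(I) / 𝔪 𝓡(I))` of a graded family, with respect to an ideal `𝔪`
of the base ring (Krull dimension). -/
noncomputable def analyticSpread (m : Ideal R) (I : GradedFamily R) : WithBot ℕ∞ :=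
  ringKrullDim (I.reesAlg ⧸ m.map (algebraMap R I.reesAlg))

/-- The ideals of the `a`-th truncation of `{I_k}`: `I_{a,k} = I_k` for `k ≤ a`, and
`I_{a,k} = ∑_{i,j > 0, i+j = k} I_{a,i} I_{a,j}` for `k > a`. -/
def truncIdeal (I : GradedFamily R) (a k : ℕ) : Ideal R :=
  if k ≤ a then I.ideal k
  else ⨆ (i : ℕ) (j : ℕ) (_ : 0 < i ∧ 0 < j ∧ i + j = k), truncIdeal I a i * truncIdeal I a j
termination_by k

theorem truncIdeal_of_le (I : GradedFamily R) {a k : ℕ} (h : k ≤ a) :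
    I.truncIdeal a k = I.ideal k := by
  rw [truncIdeal, if_pos h]

/-- The `a`-th truncation of a graded family. -/
def truncation (I : GradedFamily R) (a : ℕ) : GradedFamily R where
  ideal := I.truncIdeal a
  ideal_zero := by rw [truncIdeal_of_le I (Nat.zero_le a), I.ideal_zero]
  ideal_mul_le p q := by
    rcases Nat.eq_zero_or_pos p with rfl | hp
    · rw [zero_add]; exact Ideal.mul_le_right
    rcases Nat.eq_zero_or_pos q with rfl | hq
    · rw [add_zero]; exact Ideal.mul_le_left
    by_cases h : p + q ≤ a
    · rw [truncIdeal_of_le I h, truncIdeal_of_le I (by omega : p ≤ a),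
        truncIdeal_of_le I (by omega : q ≤ a)]
      exact I.ideal_mul_le p q
    · rw [truncIdeal.eq_1 I a (p + q), if_neg h]
      exact le_iSup₂_of_le p q (le_iSup_of_le ⟨hp, hq, rfl⟩ le_rfl)

/-- `e` is an admissible exponent for the `a`-th truncation: `e ≥ 1` and the `e`-th Veronese
subalgebra of the Rees algebra of the `a`-th truncation is standard graded. -/
structure IsTruncExponent (I : GradedFamily R) (a e : ℕ) : Prop where
  pos : 0 < e
  standard : (I.truncation a).VeroneseIsStandard e

/-- The ideals of the `a`-th upper truncation of `{I_k}` (for the exponent `e = e_a`):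
`I*_{a,k} = I_k` for `k ≤ a`, `I*_{a,k} = (I_e)^r` for `k = r e`, and otherwise
`I*_{a,k} = ∑_{i,j > 0, i+j = k} I*_{a,i} I*_{a,j}`.  (If `r e ≤ a` and `e` is admissible, the
first two clauses agree: see `GradedFamily.IsTruncExponent.ideal_mul_eq_pow`.) -/
def upperTruncIdeal (I : GradedFamily R) (a e k : ℕ) : Ideal R :=
  if k ≤ a then I.ideal k
  else if e ∣ k then I.ideal e ^ (k / e)
  else ⨆ (i : ℕ) (j : ℕ) (_ : 0 < i ∧ 0 < j ∧ i + j = k),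
    upperTruncIdeal I a e i * upperTruncIdeal I a e j
termination_by k

theorem upperTruncIdeal_of_le (I : GradedFamily R) {a e k : ℕ} (h : k ≤ a) :
    I.upperTruncIdeal a e k = I.ideal k := by
  rw [upperTruncIdeal, if_pos h]

theorem truncIdeal_le (I : GradedFamily R) (a k : ℕ) : I.truncIdeal a k ≤ I.ideal k := by
  induction k using Nat.strong_induction_on with
  | _ k ih =>
    rw [truncIdeal]
    split_ifs with h
    · exact le_rfl
    · refine iSup_le fun i => iSup_le fun j => iSup_le fun hij => ?_
      obtain ⟨hi, hj, rfl⟩ := hij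
      exact (Ideal.mul_mono (ih i (by omega)) (ih j (by omega))).trans (I.ideal_mul_le i j)

theorem pow_le_ideal (I : GradedFamily R) (e r : ℕ) : I.ideal e ^ r ≤ I.ideal (r * e) := by
  induction r with
  | zero => simp [I.ideal_zero]
  | succ r ih =>
    rw [pow_succ, Nat.succ_mul]
    exact (Ideal.mul_mono ih le_rfl).trans (I.ideal_mul_le _ _)

theorem VeroneseIsStandard.ideal_mul_le_pow {I : GradedFamily R} {e : ℕ} (he : 0 < e)
    (h : I.VeroneseIsStandard e) (r : ℕ) : I.ideal (r * e) ≤ I.ideal e ^ r := by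
  intro x hx
  have hle : Algebra.adjoin R {f : R[X] | ∃ x ∈ I.ideal e, f = monomial e x} ≤
      (powers (I.ideal e)).reesAlg.map (expand R e) := by
    refine Algebra.adjoin_le ?_
    rintro _ ⟨y, hy, rfl⟩
    refine ⟨monomial 1 y, fun i => ?_, ?_⟩
    · rw [coeff_monomial]
      split_ifs with hi
      · subst hi; simpa [powers] using hy
      · exact Ideal.zero_mem _
    · simp [expand_monomial]
  have hmem : monomial (r * e) x ∈ I.veronese e := by
    refine ⟨fun i => ?_, fun i hi => ?_⟩
    · rw [coeff_monomial]
      split_ifs with h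
      · exact h ▸ hx
      · exact Ideal.zero_mem _
    · rw [coeff_monomial, if_neg]
      rintro rfl
      exact hi (dvd_mul_left e r)
  rw [VeroneseIsStandard] at h
  rw [← h] at hmem
  obtain ⟨f, hf, hfx⟩ := hle hmem
  have hc : f.coeff r = x := by
    have := congrArg (fun g : R[X] => g.coeff (r * e)) hfx
    simpa [coeff_expand_mul he] using this
  exact hc ▸ hf r

theorem IsTruncExponent.truncIdeal_le_pow {I : GradedFamily R} {a e : ℕ}
    (h : I.IsTruncExponent a e) (r : ℕ) : I.truncIdeal a (r * e) ≤ I.ideal e ^ r :=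
  (h.standard.ideal_mul_le_pow h.pos r).trans (Ideal.pow_right_mono (I.truncIdeal_le a e) r)

theorem IsTruncExponent.ideal_mul_eq_pow {I : GradedFamily R} {a e : ℕ}
    (h : I.IsTruncExponent a e) {r : ℕ} (hr : r * e ≤ a) : I.ideal (r * e) = I.ideal e ^ r := by
  refine le_antisymm ?_ (I.pow_le_ideal e r)
  rw [← I.truncIdeal_of_le hr]
  exact h.truncIdeal_le_pow r

theorem upperTruncIdeal_le_iSup (I : GradedFamily R) (a e k : ℕ) :
    I.upperTruncIdeal a e k ≤
      ⨆ (s : ℕ) (t : ℕ) (_ : s * e + t = k), I.ideal e ^ s * I.truncIdeal a t := by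
  induction k using Nat.strong_induction_on with
  | _ k ih =>
    rw [upperTruncIdeal]
    split_ifs with h h'
    · refine le_iSup₂_of_le 0 k (le_iSup_of_le (by omega) ?_)
      rw [I.truncIdeal_of_le h, pow_zero, one_mul]
    · refine le_iSup₂_of_le (k / e) 0 (le_iSup_of_le (by rw [add_zero, Nat.div_mul_cancel h']) ?_)
      rw [I.truncIdeal_of_le (Nat.zero_le a), I.ideal_zero, Ideal.mul_top]
    · refine iSup_le fun i => iSup_le fun j => iSup_le fun hij => ?_
      obtain ⟨hi, hj, rfl⟩ := hij
      refine (Ideal.mul_mono (ih i (by omega)) (ih j (by omega))).trans ?_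
      simp only [Ideal.iSup_mul, Ideal.mul_iSup]
      refine iSup_le fun s' => iSup_le fun t' => iSup_le fun h2 => iSup_le fun s => iSup_le fun t =>
        iSup_le fun h1 => ?_
      refine le_iSup₂_of_le (s + s') (t + t') (le_iSup_of_le (by rw [← h1, ← h2]; ring) ?_)
      rw [pow_add, mul_mul_mul_comm]
      exact Ideal.mul_mono le_rfl ((I.truncation a).ideal_mul_le t t')

/-- The `a`-th upper truncation of a graded family, for an admissible exponent `e = e_a`. -/
def upperTruncation (I : GradedFamily R) (a e : ℕ) (h : I.IsTruncExponent a e) :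
    GradedFamily R where
  ideal := I.upperTruncIdeal a e
  ideal_zero := by rw [upperTruncIdeal_of_le I (Nat.zero_le a), I.ideal_zero]
  ideal_mul_le p q := by
    rcases Nat.eq_zero_or_pos p with rfl | hp
    · rw [zero_add]; exact Ideal.mul_le_right
    rcases Nat.eq_zero_or_pos q with rfl | hq
    · rw [add_zero]; exact Ideal.mul_le_left
    by_cases h1 : p + q ≤ a
    · rw [upperTruncIdeal_of_le I h1, upperTruncIdeal_of_le I (by omega : p ≤ a),
        upperTruncIdeal_of_le I (by omega : q ≤ a)]
      exact I.ideal_mul_le p q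
    by_cases h2 : e ∣ p + q
    · rw [upperTruncIdeal.eq_1 I a e (p + q), if_neg h1, if_pos h2]
      obtain ⟨r, hr⟩ := h2
      rw [hr, Nat.mul_div_cancel_left r h.pos]
      refine (Ideal.mul_mono (I.upperTruncIdeal_le_iSup a e p)
        (I.upperTruncIdeal_le_iSup a e q)).trans ?_
      simp only [Ideal.iSup_mul, Ideal.mul_iSup]
      refine iSup_le fun s' => iSup_le fun t' => iSup_le fun h4 => iSup_le fun s => iSup_le fun t =>
        iSup_le fun h3 => ?_
      rw [mul_mul_mul_comm, ← pow_add]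
      have h5 : (s + s') * e + (t + t') = r * e := by
        rw [mul_comm r e, ← hr, ← h3, ← h4]; ring
      have h6 : s + s' ≤ r := Nat.le_of_mul_le_mul_right (by omega) h.pos
      obtain ⟨u, rfl⟩ := Nat.exists_eq_add_of_le h6
      have h7 : t + t' = u * e := by
        rw [add_mul (s + s') u e] at h5
        exact Nat.add_left_cancel h5
      rw [pow_add (I.ideal e) (s + s') u]
      refine Ideal.mul_mono le_rfl (((I.truncation a).ideal_mul_le t t').trans ?_)
      rw [h7]
      exact h.truncIdeal_le_pow u
    · rw [upperTruncIdeal.eq_1 I a e (p + q), if_neg h1, if_neg h2]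
      exact le_iSup₂_of_le p q (le_iSup_of_le ⟨hp, hq, rfl⟩ le_rfl)

section Homogeneous

attribute [local instance] MvPolynomial.gradedAlgebra

/-- All ideals of the family are homogeneous for the standard grading of `k[x_1, …, x_n]`. -/
def IsHomogeneous {K : Type*} [Field K] {n : ℕ} (I : GradedFamily (MvPolynomial (Fin n) K)) :
    Prop :=
  ∀ k : ℕ, (I.ideal k).IsHomogeneous (MvPolynomial.homogeneousSubmodule (Fin n) K)

end Homogeneous

end GradedFamily

/-! The bound is obtained by measuring dimension with algebraically independent elements. The fiber
ring of `I` need not be finitely generated over `K`, but in any `K`-algebra a chain of primes of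
length `d` produces `d` algebraically independent elements (`LTSeries.exists_algebraicIndependent`).
If `d ≤ ℓ(I)`, lift such elements of the fiber ring to the Rees algebra. The lifts have bounded
degree in `t`, and the `a`-th upper truncation agrees with `I` up to degree `a`, so for large `a`
they lie in its Rees algebra, and their classes in its fiber ring are still independent. That ring
is integral over the fiber ring of the powers of `I_{e_a}`, which is finitely generated, and Noether
normalization gives `d ≤ ℓ(I_{e_a})`.

The two sets of values agree term by term: the `e_a`-th Veronese of the upper truncation is the
family of powers of `I_{e_a}`, and `t ↦ t^e` induces an injective integral map of fiber rings
(`analyticSpread_eq_of_ideal_mul_eq`). The maxima exist because every analytic spread lies in `{0,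
…, n}` (`analyticSpread_le`). Admissible exponents exist because `e = a * a!` works, by a pigeonhole
argument. -/

section CommutativeAlgebra

/-! ### Chains of primes and algebraic independence -/

/-- If `a ∈ Q \ P` for primes `P ≤ Q` and `y` is algebraically independent modulo `Q`, then adjoining
`a` to `y` gives a family which is algebraically independent modulo `P`. -/
theorem Ideal.IsPrime.eq_zero_of_aeval_cons_mem {K A : Type*} [Field K] [CommRing A] [Algebra K A]
    {P Q : Ideal A} [P.IsPrime] (hPQ : P ≤ Q) {a : A} (haQ : a ∈ Q) (haP : a ∉ P) {d : ℕ}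
    {y : Fin d → A} (hy : ∀ f : MvPolynomial (Fin d) K, MvPolynomial.aeval y f ∈ Q → f = 0)
    (f : MvPolynomial (Fin (d + 1)) K)
    (hf : MvPolynomial.aeval (Fin.cons a y : Fin (d + 1) → A) f ∈ P) : f = 0 := by
  -- Regard `f` as a polynomial `g` in the variable sent to `a`. Modulo `Q` only the constant
  -- coefficient survives, and it vanishes by `hy`. What remains is `a` times the value of `g.divX`;
  -- since `a ∉ P`, the factor `a` cancels modulo the prime `P` and the next coefficient is reached.
  have key : ∀ (m : ℕ) (g : Polynomial (MvPolynomial (Fin d) K)),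
      Polynomial.eval₂ (MvPolynomial.aeval y).toRingHom a g ∈ P → g.coeff m = 0 := by
    intro m
    induction m with
    | zero =>
      intro g hg
      rw [← Polynomial.divX_mul_X_add g, Polynomial.eval₂_add, Polynomial.eval₂_mul,
        Polynomial.eval₂_X, Polynomial.eval₂_C] at hg
      exact hy _ ((Ideal.add_mem_iff_right Q (Q.mul_mem_left _ haQ)).mp (hPQ hg))
    | succ m ih =>
      intro g hg
      have h0 : g.coeff 0 = 0 := by
        rw [← Polynomial.divX_mul_X_add g, Polynomial.eval₂_add, Polynomial.eval₂_mul,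
          Polynomial.eval₂_X, Polynomial.eval₂_C] at hg
        exact hy _ ((Ideal.add_mem_iff_right Q (Q.mul_mem_left _ haQ)).mp (hPQ hg))
      rw [← Polynomial.divX_mul_X_add g, h0, Polynomial.eval₂_add, Polynomial.eval₂_mul,
        Polynomial.eval₂_X, Polynomial.C_0, Polynomial.eval₂_zero, add_zero] at hg
      rw [← Polynomial.coeff_divX]
      exact ih _ ((Ideal.IsPrime.mem_or_mem ‹_› hg).resolve_right haP)
  have hcomp : ∀ f : MvPolynomial (Fin (d + 1)) K,
      MvPolynomial.aeval (Fin.cons a y : Fin (d + 1) → A) f =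
        Polynomial.eval₂ (MvPolynomial.aeval y).toRingHom a (MvPolynomial.finSuccEquiv K d f) := by
    intro f
    induction f using MvPolynomial.induction_on with
    | C r => simp [MvPolynomial.finSuccEquiv_apply]
    | add p q hp hq => rw [map_add, map_add, Polynomial.eval₂_add, hp, hq]
    | mul_X p i hp =>
      rw [map_mul, map_mul, Polynomial.eval₂_mul, hp, MvPolynomial.aeval_X]
      congr 1
      refine Fin.cases ?_ (fun j => ?_) i
      · simp [MvPolynomial.finSuccEquiv_X_zero]
      · simp [MvPolynomial.finSuccEquiv_X_succ]
  rw [hcomp] at hf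
  refine (MvPolynomial.finSuccEquiv K d).injective ?_
  rw [map_zero]
  ext1 m
  rw [key m _ hf, Polynomial.coeff_zero]

/-- A chain of primes of length `d` in an algebra over a field yields `d` elements which are
algebraically independent modulo the smallest prime. -/
theorem LTSeries.exists_algebraicIndependent {K A : Type*} [Field K] [CommRing A] [Algebra K A]
    (l : LTSeries (PrimeSpectrum A)) {d : ℕ} (hd : l.length = d) : ∃ y : Fin d → A,
      ∀ f : MvPolynomial (Fin d) K, MvPolynomial.aeval y f ∈ l.head.asIdeal → f = 0 := by
  induction l using RelSeries.inductionOn generalizing d with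
  | singleton P =>
    obtain rfl : 0 = d := hd
    refine ⟨Fin.elim0, fun f hf => ?_⟩
    obtain ⟨c, rfl⟩ := MvPolynomial.C_surjective (R := K) (Fin 0) f
    rw [MvPolynomial.aeval_C] at hf
    by_contra hc
    have hc' : c ≠ 0 := by
      rintro rfl
      exact hc (map_zero _)
    exact P.isPrime.ne_top (Ideal.eq_top_of_isUnit_mem _ hf ((IsUnit.mk0 c hc').map _))
  | cons p P hP ih =>
    obtain ⟨y, hy⟩ := ih rfl
    obtain rfl : p.length + 1 = d := by rw [← hd, RelSeries.cons_length]
    have hlt : P < p.head := hP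
    obtain ⟨a, haQ, haP⟩ := SetLike.exists_of_lt (show P.asIdeal < p.head.asIdeal from hlt)
    refine ⟨Fin.cons a y, fun f hf => ?_⟩
    rw [RelSeries.head_cons] at hf
    exact Ideal.IsPrime.eq_zero_of_aeval_cons_mem (show P.asIdeal ≤ p.head.asIdeal from hlt.le)
      haQ haP hy f hf

/-- Independence modulo a prime is stronger than independence. No finiteness of `A` is required, so
this applies to the fiber ring of an arbitrary graded family. -/
theorem exists_algebraicIndependent_of_le_ringKrullDim (K : Type*) {A : Type*} [Field K]
    [CommRing A] [Algebra K A] {d : ℕ} (h : (d : WithBot ℕ∞) ≤ ringKrullDim A) :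
    ∃ y : Fin d → A, AlgebraicIndependent K y := by
  obtain ⟨l, hl⟩ := Order.le_krullDim_iff.mp h
  obtain ⟨y, hy⟩ := LTSeries.exists_algebraicIndependent (K := K) l hl
  exact ⟨y, algebraicIndependent_iff.mpr fun f hf => hy f (hf ▸ Ideal.zero_mem _)⟩

/-- The Krull dimension of an algebra over a field is bounded by the transcendence degree of any
algebra containing it. -/
theorem ringKrullDim_le_of_injective_of_trdeg_le {K A B : Type*} [Field K] [CommRing A]
    [CommRing B] [Algebra K A] [Algebra K B] (f : A →ₐ[K] B) (hf : Function.Injective f) {n : ℕ}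
    (hn : Algebra.trdeg K B ≤ n) : ringKrullDim A ≤ n := by
  refine iSup_le fun l => ?_
  obtain ⟨y, hy⟩ := exists_algebraicIndependent_of_le_ringKrullDim K (Order.LTSeries.length_le_krullDim l)
  have h := (hy.map' hf).lift_cardinalMk_le_trdeg.trans (Cardinal.lift_le.mpr hn)
  simp only [Cardinal.mk_fin, Cardinal.lift_natCast, Nat.cast_le] at h
  exact_mod_cast h

/-! ### Dimension and independence under integral maps -/

/-- Incomparability: contraction of primes along an integral map is strictly monotone. -/
theorem ringKrullDim_le_of_isIntegral (A B : Type*) [CommRing A] [CommRing B] [Algebra A B]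
    [Algebra.IsIntegral A B] : ringKrullDim B ≤ ringKrullDim A :=
  Order.krullDim_le_of_strictMono (PrimeSpectrum.comap (algebraMap A B))
    fun P _ h => Ideal.IsIntegral.comap_lt_comap (I := P.asIdeal) h

/-- Lying over starts the chain and going up extends it. The contraction of the last prime is
recorded so that the induction can continue at the top. -/
theorem LTSeries.exists_comap_last_eq_of_isIntegral {A B : Type*} [CommRing A] [CommRing B]
    [Algebra A B] [Algebra.IsIntegral A B] [FaithfulSMul A B] (l : LTSeries (PrimeSpectrum A)) :
    ∃ l' : LTSeries (PrimeSpectrum B), l'.length = l.length ∧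
      PrimeSpectrum.comap (algebraMap A B) l'.last = l.last := by
  induction l using RelSeries.inductionOn' with
  | singleton P =>
    obtain ⟨Q, -, hQ, hQP⟩ := Ideal.exists_ideal_over_prime_of_isIntegral (S := B) P.asIdeal ⊥ (by
      rw [← RingHom.ker_eq_comap_bot, (RingHom.injective_iff_ker_eq_bot _).mp
        (FaithfulSMul.algebraMap_injective A B)]
      exact bot_le)
    exact ⟨RelSeries.singleton _ ⟨Q, hQ⟩, rfl, PrimeSpectrum.ext hQP⟩
  | snoc p P hP ih =>
    obtain ⟨l', hlen, hlast⟩ := ih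
    have hlt : p.last < P := hP
    obtain ⟨Q, hle, hQ, hQP⟩ := Ideal.exists_ideal_over_prime_of_isIntegral P.asIdeal
      l'.last.asIdeal (by
        rw [← PrimeSpectrum.comap_asIdeal, hlast]
        exact hlt.le)
    have hlt' : l'.last < ⟨Q, hQ⟩ := by
      refine lt_of_le_of_ne hle fun h => hlt.ne ?_
      rw [← hlast, h]
      exact PrimeSpectrum.ext hQP
    refine ⟨l'.snoc ⟨Q, hQ⟩ hlt', by simp [hlen], ?_⟩
    rw [RelSeries.last_snoc, RelSeries.last_snoc]
    exact PrimeSpectrum.ext hQP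

theorem ringKrullDim_eq_of_isIntegral (A B : Type*) [CommRing A] [CommRing B] [Algebra A B]
    [Algebra.IsIntegral A B] [FaithfulSMul A B] : ringKrullDim A = ringKrullDim B := by
  refine le_antisymm (iSup_le fun l => ?_) (ringKrullDim_le_of_isIntegral A B)
  obtain ⟨l', hlen, -⟩ := l.exists_comap_last_eq_of_isIntegral (B := B)
  rw [← hlen]
  exact Order.LTSeries.length_le_krullDim l'

theorem RingHom.IsIntegral.ringKrullDim_eq {A B : Type*} [CommRing A] [CommRing B] {f : A →+* B}
    (hf : f.IsIntegral) (hinj : Function.Injective f) : ringKrullDim A = ringKrullDim B := by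
  algebraize [f]
  have : FaithfulSMul A B := (faithfulSMul_iff_algebraMap_injective A B).mpr hinj
  exact ringKrullDim_eq_of_isIntegral A B

/-- Some prime `P` of `B` contracts to zero in `K[Y_1, …, Y_d]`, so `y` stays independent in the
domain `B ⧸ P`. This domain is integral over a subalgebra with `s` generators, hence has
transcendence degree at most `s`. -/
theorem natCast_le_of_algebraicIndependent_of_isIntegral {K B : Type*} [Field K] [CommRing B]
    [Algebra K B] {s d : ℕ} (g : MvPolynomial (Fin s) K →ₐ[K] B) (hg : g.IsIntegral)
    {y : Fin d → B} (hy : AlgebraicIndependent K y) : d ≤ s := by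
  obtain ⟨P, hP, hPy⟩ := Ideal.exists_comap_eq_of_mem_minimalPrimes_of_injective
    (f := (MvPolynomial.aeval (R := K) y).toRingHom) hy ⊥
    (by simp [IsDomain.minimalPrimes_eq_singleton_bot])
  let π : B →ₐ[K] B ⧸ P := Ideal.Quotient.mkₐ K P
  have hyP : AlgebraicIndependent K (π ∘ y) := by
    refine algebraicIndependent_iff.mpr fun f hf => ?_
    have hf' : π (MvPolynomial.aeval y f) = 0 := by
      rw [← hf, MvPolynomial.comp_aeval_apply]
      rfl
    have : f ∈ Ideal.comap (MvPolynomial.aeval (R := K) y).toRingHom P :=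
      Ideal.mem_comap.mpr (Ideal.Quotient.eq_zero_iff_mem.mp hf')
    rwa [hPy] at this
  have hint : (π.comp g).IsIntegral :=
    hg.trans _ _ (RingHom.isIntegral_of_surjective _ Ideal.Quotient.mk_surjective)
  let S : Set (B ⧸ P) := Set.range fun i => (π.comp g) (MvPolynomial.X i)
  have hS : ∀ f, (π.comp g) f ∈ Algebra.adjoin K S := by
    intro f
    have : (π.comp g) = MvPolynomial.aeval fun i => (π.comp g) (MvPolynomial.X i) :=
      MvPolynomial.algHom_ext (by simp)
    rw [this, Algebra.adjoin_range_eq_range_aeval]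
    exact ⟨f, rfl⟩
  have : Algebra.IsIntegral (Algebra.adjoin K S) (B ⧸ P) := by
    refine ⟨fun b => ?_⟩
    obtain ⟨p, hp, hpb⟩ := hint b
    refine ⟨p.map ((π.comp g).codRestrict _ hS).toRingHom, hp.map _, ?_⟩
    rw [Polynomial.eval₂_map]
    exact hpb
  have hle := hyP.lift_cardinalMk_le_trdeg.trans
    (Cardinal.lift_le.mpr (Algebra.IsAlgebraic.trdeg_le_cardinalMk K S))
  have hle' := hle.trans Cardinal.mk_range_le_lift
  simpa using hle'

/-- If `B` is integral over a finitely generated `K`-algebra `A`, then `B` contains at most `dim A`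
algebraically independent elements. -/
theorem AlgebraicIndependent.natCast_le_ringKrullDim {K A B : Type*} [Field K] [CommRing A]
    [CommRing B] [Algebra K A] [Algebra K B] [Algebra.FiniteType K A] [Nontrivial A]
    (f : A →ₐ[K] B) (hf : f.toRingHom.IsIntegral) {d : ℕ} {y : Fin d → B}
    (hy : AlgebraicIndependent K y) : (d : WithBot ℕ∞) ≤ ringKrullDim A := by
  -- Noether normalization: `A` is integral over a polynomial ring in `s` variables, so `dim A = s`,
  -- and `B` is integral over the same polynomial ring.
  obtain ⟨s, g, hinj, hint⟩ := exists_integral_inj_algHom_of_fg K A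
  have hs : ringKrullDim A = s := by
    rw [← hint.ringKrullDim_eq hinj]
    simp
  rw [hs]
  exact_mod_cast natCast_le_of_algebraicIndependent_of_isIntegral (f.comp g)
    (hint.trans _ _ hf) hy

end CommutativeAlgebra

namespace GradedFamily

open Polynomial

/-! ### Rees algebras, Veronese maps and fiber rings -/

section FiberRing

variable {R : Type*} [CommRing R]

theorem monomial_mem_reesAlg {I : GradedFamily R} {i : ℕ} {x : R} (hx : x ∈ I.ideal i) :
    monomial i x ∈ I.reesAlg := fun j => by
  rw [coeff_monomial]
  split_ifs with h
  · exact h ▸ hx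
  · exact Ideal.zero_mem _

/-- The extension of an ideal `m` to the Rees algebra is `⨁ m I_k t^k`. -/
theorem mem_map_algebraMap_reesAlg {I : GradedFamily R} {m : Ideal R} {f : I.reesAlg} :
    f ∈ m.map (algebraMap R I.reesAlg) ↔ ∀ i, (f : R[X]).coeff i ∈ m * I.ideal i := by
  constructor
  · intro hf
    induction hf using Submodule.span_induction with
    | mem x hx =>
      intro i
      obtain ⟨r, hr, rfl⟩ := hx
      change (C r : R[X]).coeff i ∈ _
      rw [coeff_C]
      split_ifs with h
      · subst h
        rwa [I.ideal_zero, Ideal.mul_top]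
      · exact Ideal.zero_mem _
    | zero => exact fun i => Ideal.zero_mem _
    | add x y _ _ hx hy =>
      intro i
      rw [AddMemClass.coe_add, coeff_add]
      exact Ideal.add_mem _ (hx i) (hy i)
    | smul a x _ hx' =>
      intro i
      rw [smul_eq_mul, MulMemClass.coe_mul, coeff_mul]
      refine Ideal.sum_mem _ ?_
      rintro ⟨j, k⟩ hjk
      rw [← Finset.HasAntidiagonal.mem_antidiagonal.mp hjk]
      have h1 : (a : R[X]).coeff j * (x : R[X]).coeff k ∈ I.ideal j * (m * I.ideal k) :=
        Ideal.mul_mem_mul (a.2 j) (hx' k)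
      rw [mul_left_comm] at h1
      exact Ideal.mul_mono_right (I.ideal_mul_le j k) h1
  · intro hf
    -- One coefficient at a time: for `a ∈ m` and `b ∈ I_i`, the monomial `a b t^i` is `a` times the
    -- element `b t^i` of the Rees algebra.
    have key : ∀ i, ∀ x ∈ m * I.ideal i, ∃ g ∈ m.map (algebraMap R I.reesAlg),
        (g : R[X]) = monomial i x := by
      intro i x hx
      induction hx using Submodule.mul_induction_on' with
      | mem_mul_mem a ha b hb =>
        refine ⟨algebraMap R I.reesAlg a * ⟨monomial i b, monomial_mem_reesAlg hb⟩,
          Ideal.mul_mem_right _ _ (Ideal.mem_map_of_mem _ ha), ?_⟩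
        change C a * monomial i b = _
        rw [C_mul_monomial]
      | add x _ y _ hx hy =>
        obtain ⟨g, hg, hgx⟩ := hx
        obtain ⟨g', hg', hgy⟩ := hy
        exact ⟨g + g', Ideal.add_mem _ hg hg', by rw [AddMemClass.coe_add, hgx, hgy, map_add]⟩
    choose g hg hgx using fun i => key i _ (hf i)
    have : f = ∑ i ∈ (f : R[X]).support, g i := by
      apply Subtype.ext
      rw [AddSubmonoidClass.coe_finsetSum]
      conv_lhs => rw [as_sum_support (f : R[X])]
      exact Finset.sum_congr rfl fun i _ => (hgx i).symm
    rw [this]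
    exact Ideal.sum_mem _ fun i _ => hg i

/-- If `J_k = I_{ke}` for all `k`, then `t ↦ t^e` maps the Rees algebra of `J` into that of `I`. -/
noncomputable def expandReesAlg (I J : GradedFamily R) {e : ℕ} (he : 0 < e)
    (h : ∀ r, I.ideal (r * e) = J.ideal r) : J.reesAlg →ₐ[R] I.reesAlg :=
  ((expand R e).comp J.reesAlg.val).codRestrict I.reesAlg fun f i => by
    change (expand R e (f : R[X])).coeff i ∈ _
    rw [coeff_expand he]
    split_ifs with hi
    · obtain ⟨r, rfl⟩ := hi
      rw [Nat.mul_div_cancel_left r he, mul_comm, h]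
      exact f.2 r
    · exact Ideal.zero_mem _

theorem coe_expandReesAlg {I J : GradedFamily R} {e : ℕ} (he : 0 < e)
    (h : ∀ r, I.ideal (r * e) = J.ideal r) (f : J.reesAlg) :
    (expandReesAlg I J he h f : R[X]) = expand R e f := rfl

/-- A homogeneous element `x t^i` satisfies `(x t^i)^e = x^e t^{ie}`, the image of `x^e t^i`,
because `x^e ∈ I_{ie} = J_i`. Sums of integral elements are integral. -/
theorem isIntegral_expandReesAlg {I J : GradedFamily R} {e : ℕ} (he : 0 < e)
    (h : ∀ r, I.ideal (r * e) = J.ideal r) :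
    (expandReesAlg I J he h).toRingHom.IsIntegral := by
  intro f
  have key : ∀ i, ∃ g : I.reesAlg, (expandReesAlg I J he h).toRingHom.IsIntegralElem g ∧
      (g : R[X]) = monomial i ((f : R[X]).coeff i) := by
    intro i
    refine ⟨⟨_, monomial_mem_reesAlg (f.2 i)⟩, ?_, rfl⟩
    have hmem : (f : R[X]).coeff i ^ e ∈ J.ideal i := by
      rw [← h, mul_comm]
      exact I.pow_le_ideal i e (Ideal.pow_mem_pow (f.2 i) e)
    let G : J.reesAlg := ⟨monomial i ((f : R[X]).coeff i ^ e), monomial_mem_reesAlg hmem⟩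
    refine ⟨X ^ e - C G, monic_X_pow_sub_C _ he.ne', ?_⟩
    rw [eval₂_sub, eval₂_X_pow, eval₂_C, sub_eq_zero]
    apply Subtype.ext
    change (monomial i ((f : R[X]).coeff i)) ^ e = expand R e (monomial i ((f : R[X]).coeff i ^ e))
    rw [expand_monomial, monomial_pow]
  choose g hg hgf using key
  have : f = ∑ i ∈ (f : R[X]).support, g i := by
    apply Subtype.ext
    rw [AddSubmonoidClass.coe_finsetSum]
    conv_lhs => rw [as_sum_support (f : R[X])]
    exact Finset.sum_congr rfl fun i _ => (hgf i).symm
  rw [this]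
  let := (expandReesAlg I J he h).toRingHom.toAlgebra
  exact IsIntegral.sum _ fun i _ => hg i

/-- The fiber ring `𝓡(I) / m 𝓡(I)` of a graded family. -/
def Fiber (m : Ideal R) (I : GradedFamily R) : Type _ :=
  I.reesAlg ⧸ m.map (algebraMap R I.reesAlg)

noncomputable instance (m : Ideal R) (I : GradedFamily R) : CommRing (Fiber m I) :=
  Ideal.Quotient.commRing _

theorem analyticSpread_eq_ringKrullDim_fiber (m : Ideal R) (I : GradedFamily R) :
    I.analyticSpread m = ringKrullDim (Fiber m I) := rfl

/-- The quotient map from the Rees algebra to the fiber ring. -/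
noncomputable def fiberMk (m : Ideal R) (I : GradedFamily R) : I.reesAlg →+* Fiber m I :=
  Ideal.Quotient.mk _

theorem fiberMk_surjective (m : Ideal R) (I : GradedFamily R) :
    Function.Surjective (fiberMk m I) :=
  Ideal.Quotient.mk_surjective

theorem fiberMk_eq_zero_iff {m : Ideal R} {I : GradedFamily R} {f : I.reesAlg} :
    fiberMk m I f = 0 ↔ f ∈ m.map (algebraMap R I.reesAlg) :=
  Ideal.Quotient.eq_zero_iff_mem

noncomputable instance {K : Type*} [CommRing K] [Algebra K R] (m : Ideal R)
    (I : GradedFamily R) : Algebra K (Fiber m I) :=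
  ((fiberMk m I).comp (algebraMap K I.reesAlg)).toAlgebra

instance {K : Type*} [CommRing K] [Algebra K R] (m : Ideal R) (I : GradedFamily R) :
    IsScalarTower K R (Fiber m I) :=
  IsScalarTower.of_algebraMap_eq fun r => by
    change fiberMk m I _ = fiberMk m I _
    rw [IsScalarTower.algebraMap_apply K R I.reesAlg]

/-- The map of fiber rings induced by a map of Rees algebras. -/
noncomputable def fiberMap (m : Ideal R) {I J : GradedFamily R} (f : J.reesAlg →ₐ[R] I.reesAlg) :
    Fiber m J →ₐ[R] Fiber m I where
  toRingHom := Ideal.Quotient.lift _ ((fiberMk m I).comp f.toRingHom) (by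
    intro x hx
    have h : (m.map (algebraMap R J.reesAlg)).map f.toRingHom ≤
        m.map (algebraMap R I.reesAlg) := by
      rw [Ideal.map_map]
      exact le_of_eq (congrArg (fun g => Ideal.map g m) f.comp_algebraMap)
    exact fiberMk_eq_zero_iff.mpr (h (Ideal.mem_map_of_mem _ hx)))
  commutes' r := congrArg (fiberMk m I) (f.commutes r)

theorem fiberMap_fiberMk (m : Ideal R) {I J : GradedFamily R} (f : J.reesAlg →ₐ[R] I.reesAlg)
    (x : J.reesAlg) : fiberMap m f (fiberMk m J x) = fiberMk m I (f x) := rfl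

theorem isIntegral_fiberMap (m : Ideal R) {I J : GradedFamily R} {f : J.reesAlg →ₐ[R] I.reesAlg}
    (hf : f.toRingHom.IsIntegral) : (fiberMap m f).toRingHom.IsIntegral :=
  RingHom.IsIntegral.tower_top (fiberMk m J) _
    (hf.trans _ _ (RingHom.isIntegral_of_surjective _ (fiberMk_surjective m I)))

/-- The coefficient of `f` at `i` reappears at `i * e`, and `m I_{ie} = m J_i`, so lying in the
extension of `m` is the same condition before and after expansion. -/
theorem injective_fiberMap_expandReesAlg (m : Ideal R) {I J : GradedFamily R} {e : ℕ}
    (he : 0 < e) (h : ∀ r, I.ideal (r * e) = J.ideal r) :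
    Function.Injective (fiberMap m (expandReesAlg I J he h)) := by
  rw [injective_iff_map_eq_zero]
  intro x hx
  obtain ⟨f, rfl⟩ := fiberMk_surjective m J x
  rw [fiberMap_fiberMk, fiberMk_eq_zero_iff, mem_map_algebraMap_reesAlg] at hx
  rw [fiberMk_eq_zero_iff, mem_map_algebraMap_reesAlg]
  intro i
  have := hx (i * e)
  rwa [h, coe_expandReesAlg, coeff_expand_mul he] at this

/-- The analytic spread is not changed by passing to a Veronese subfamily. -/
theorem analyticSpread_eq_of_ideal_mul_eq (m : Ideal R) {I J : GradedFamily R} {e : ℕ}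
    (he : 0 < e) (h : ∀ r, I.ideal (r * e) = J.ideal r) :
    I.analyticSpread m = J.analyticSpread m :=
  ((isIntegral_fiberMap m (isIntegral_expandReesAlg he h)).ringKrullDim_eq
    (injective_fiberMap_expandReesAlg m he h)).symm

theorem nontrivial_fiber (I : GradedFamily R) {m : Ideal R} (hm : m ≠ ⊤) :
    Nontrivial (Fiber m I) := by
  refine ⟨1, 0, fun h => ?_⟩
  rw [← map_one (fiberMk m I), fiberMk_eq_zero_iff, mem_map_algebraMap_reesAlg] at h
  have := h 0
  rw [I.ideal_zero, Ideal.mul_top, OneMemClass.coe_one, coeff_one_zero] at this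
  exact hm ((Ideal.eq_top_iff_one m).mpr this)

instance finiteType_powers_reesAlg [IsNoetherianRing R] (J : Ideal R) :
    Algebra.FiniteType R (powers J).reesAlg :=
  inferInstanceAs (Algebra.FiniteType R (reesAlgebra J))

instance finiteType_fiber_powers [IsNoetherianRing R] (m J : Ideal R) :
    Algebra.FiniteType R (Fiber m (powers J)) :=
  Algebra.FiniteType.of_surjective (A := (powers J).reesAlg)
    { fiberMk m (powers J) with commutes' := fun _ => rfl } (fiberMk_surjective m _)

end FiberRing

/-! ### Analytic spread of upper truncations -/

section UpperTruncation

variable {R : Type*} [CommRing R] (I : GradedFamily R)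

theorem upperTruncIdeal_le (a e k : ℕ) : I.upperTruncIdeal a e k ≤ I.ideal k := by
  refine (I.upperTruncIdeal_le_iSup a e k).trans ?_
  refine iSup_le fun s => iSup_le fun t => iSup_le fun hst => ?_
  rw [← hst]
  exact (Ideal.mul_mono (I.pow_le_ideal e s) (I.truncIdeal_le a t)).trans (I.ideal_mul_le _ _)

theorem upperTruncIdeal_mul_eq_pow {a e : ℕ} (h : I.IsTruncExponent a e) (r : ℕ) :
    I.upperTruncIdeal a e (r * e) = I.ideal e ^ r := by
  rw [upperTruncIdeal]
  split_ifs with h1 h2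
  · exact h.ideal_mul_eq_pow h1
  · rw [Nat.mul_div_cancel _ h.pos]
  · exact absurd (dvd_mul_left e r) h2

theorem analyticSpread_upperTruncation (m : Ideal R) {a e : ℕ} (h : I.IsTruncExponent a e) :
    (I.upperTruncation a e h).analyticSpread m = (powers (I.ideal e)).analyticSpread m :=
  analyticSpread_eq_of_ideal_mul_eq m h.pos (I.upperTruncIdeal_mul_eq_pow h)

/-- If the analytic spread of a family is at least `d`, then so is the analytic spread of its upper
truncations in high degree. -/
theorem exists_le_analyticSpread_powers {K : Type*} [Field K] [Algebra K R]
    [Algebra.FiniteType K R] [IsNoetherianRing R] {m : Ideal R} (hm : m ≠ ⊤) (e : ℕ+ → ℕ)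
    (he : ∀ a : ℕ+, I.IsTruncExponent a (e a)) {d : ℕ} (hd : (d : WithBot ℕ∞) ≤ I.analyticSpread m) :
    ∃ a : ℕ+, (d : WithBot ℕ∞) ≤ (powers (I.ideal (e a))).analyticSpread m := by
  obtain ⟨y, hy⟩ := exists_algebraicIndependent_of_le_ringKrullDim K
    (hd.trans_eq (analyticSpread_eq_ringKrullDim_fiber m I))
  choose f hf using fun i => fiberMk_surjective m I (y i)
  -- A common bound for the `t`-degrees of the lifts; the successor only ensures positivity.
  let a : ℕ+ := ⟨(Finset.univ.sup fun i => (f i : R[X]).natDegree) + 1, Nat.succ_pos _⟩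
  have ha : ∀ i, (f i : R[X]).natDegree ≤ a := fun i =>
    (Finset.le_sup (f := fun i => (f i : R[X]).natDegree) (Finset.mem_univ i)).trans
      (Nat.le_succ _)
  let T := I.upperTruncation a (e a) (he a)
  have hT : T.reesAlg ≤ I.reesAlg := fun g hg i => I.upperTruncIdeal_le _ _ _ (hg i)
  have hfT : ∀ i, (f i : R[X]) ∈ T.reesAlg := fun i j => by
    by_cases hj : j ≤ a
    · rw [show T.ideal j = I.ideal j from I.upperTruncIdeal_of_le hj]
      exact (f i).2 j
    · rw [coeff_eq_zero_of_natDegree_lt ((ha i).trans_lt (not_le.mp hj))]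
      exact Ideal.zero_mem _
  let φ := (fiberMap m (Subalgebra.inclusion hT)).restrictScalars K
  let z : Fin d → Fiber m T :=
    fun i => fiberMk m T ⟨f i, hfT i⟩
  -- The map of fiber rings `φ` need not be injective, but a relation among the `z i` would map to
  -- one among the `y i`.
  have hz : AlgebraicIndependent K z := by
    refine AlgebraicIndependent.of_comp φ ?_
    have : φ ∘ z = y := funext fun i => hf i
    rwa [this]
  have hmul : ∀ r, T.ideal (r * e a) = (powers (I.ideal (e a))).ideal r :=
    I.upperTruncIdeal_mul_eq_pow (he a)
  have := (powers (I.ideal (e a))).nontrivial_fiber hm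
  have : Algebra.FiniteType K (Fiber m (powers (I.ideal (e a)))) :=
    Algebra.FiniteType.trans (S := R) ‹_› inferInstance
  exact ⟨a, hz.natCast_le_ringKrullDim
    ((fiberMap m (expandReesAlg T _ (he a).pos hmul)).restrictScalars K)
    (isIntegral_fiberMap m (isIntegral_expandReesAlg (he a).pos hmul))⟩

end UpperTruncation

/-! ### The bound by the number of variables -/

section PolynomialRing

variable {K : Type*} [Field K] {n : ℕ}

theorem idealOfVars_ne_top : MvPolynomial.idealOfVars (Fin n) K ≠ ⊤ := by
  have h : MvPolynomial.idealOfVars (Fin n) K ≤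
      RingHom.ker (MvPolynomial.constantCoeff (σ := Fin n) (R := K)) := by
    refine Ideal.span_le.mpr ?_
    rintro _ ⟨i, rfl⟩
    exact MvPolynomial.constantCoeff_X K i
  exact fun htop => RingHom.ker_ne_top _ (top_le_iff.mp (htop ▸ h))

/-- The Rees algebra sits in `R[t]`, of transcendence degree `n + 1`, so its dimension is at most `n
+ 1`. A variable is a nonzerodivisor that dies in the fiber ring, which lowers the dimension by at
least one. -/
theorem analyticSpread_le (hn : 0 < n) (I : GradedFamily (MvPolynomial (Fin n) K)) :
    I.analyticSpread (MvPolynomial.idealOfVars (Fin n) K) ≤ n := by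
  have htr : Algebra.trdeg K (MvPolynomial (Fin n) K)[X] ≤ (n + 1 : ℕ) := by
    rw [← trdeg_add_eq K (MvPolynomial (Fin n) K), MvPolynomial.trdeg_of_isDomain,
      Polynomial.trdeg_of_isDomain]
    simp
  have hdim : ringKrullDim I.reesAlg ≤ (n + 1 : ℕ) :=
    ringKrullDim_le_of_injective_of_trdeg_le (I.reesAlg.val.restrictScalars K)
      Subtype.val_injective htr
  let x : MvPolynomial (Fin n) K := MvPolynomial.X ⟨0, hn⟩
  have hx : x ∈ MvPolynomial.idealOfVars (Fin n) K := Ideal.subset_span ⟨_, rfl⟩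
  have hx0 : algebraMap _ I.reesAlg x ∈ nonZeroDivisors I.reesAlg := by
    refine mem_nonZeroDivisors_of_ne_zero fun h => ?_
    have : (C x : (MvPolynomial (Fin n) K)[X]) = 0 := congrArg Subtype.val h
    exact MvPolynomial.X_ne_zero _ (C_eq_zero.mp this)
  have := (ringKrullDim_succ_le_of_surjective (Ideal.Quotient.mk _) Ideal.Quotient.mk_surjective hx0
    (Ideal.Quotient.eq_zero_iff_mem.mpr (Ideal.mem_map_of_mem _ hx))).trans hdim
  rw [Nat.cast_add, Nat.cast_one] at this
  exact ENat.WithBot.add_le_add_one_right_iff.mp this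

end PolynomialRing

end GradedFamily

namespace GradedFamily

open Polynomial

/-! ### Existence of admissible exponents -/

section TruncationExponent

variable {R : Type*} [CommRing R] (I : GradedFamily R)

theorem prod_pow_ideal_le (s : Finset ℕ) (c : ℕ → ℕ) :
    ∏ i ∈ s, I.ideal i ^ c i ≤ I.ideal (∑ i ∈ s, c i * i) := by
  induction s using Finset.cons_induction with
  | empty => simp [I.ideal_zero]
  | cons i s hi ih =>
    rw [Finset.prod_cons, Finset.sum_cons]
    exact (Ideal.mul_mono (I.pow_le_ideal i (c i)) ih).trans (I.ideal_mul_le _ _)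

/-- The ideals of the truncation are spanned by products of the first `a` ideals. -/
theorem truncIdeal_le_iSup_prod (a k : ℕ) : I.truncIdeal a k ≤
    ⨆ (c : ℕ → ℕ) (_ : ∑ i ∈ Finset.Icc 1 a, c i * i = k),
      ∏ i ∈ Finset.Icc 1 a, I.truncIdeal a i ^ c i := by
  induction k using Nat.strong_induction_on with
  | _ k ih =>
    rcases Nat.eq_zero_or_pos k with rfl | hk
    · exact le_iSup₂_of_le 0 (by simp) (by
        simp only [Pi.zero_apply, pow_zero, Finset.prod_const_one]
        exact Ideal.one_eq_top (R := R) ▸ le_top)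
    by_cases h : k ≤ a
    · have hmem : k ∈ Finset.Icc 1 a := Finset.mem_Icc.mpr ⟨hk, h⟩
      refine le_iSup₂_of_le (Pi.single k 1) ?_ ?_
      · rw [Finset.sum_eq_single_of_mem k hmem fun i _ hi => by simp [hi]]
        simp
      · rw [Finset.prod_eq_single_of_mem k hmem fun i _ hi => by simp [hi]]
        simp
    · rw [truncIdeal, if_neg h]
      refine iSup_le fun i => iSup_le fun j => iSup_le fun hij => ?_
      obtain ⟨hi, hj, rfl⟩ := hij
      refine (Ideal.mul_mono (ih i (by omega)) (ih j (by omega))).trans ?_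
      simp only [Ideal.iSup_mul, Ideal.mul_iSup]
      refine iSup_le fun c' => iSup_le fun h' => iSup_le fun c => iSup_le fun hc => ?_
      refine le_iSup₂_of_le (c + c') ?_ ?_
      · simp only [Pi.add_apply, add_mul, Finset.sum_add_distrib, hc, h']
      · simp only [Pi.add_apply, pow_add, Finset.prod_mul_distrib]
        exact le_rfl

/-- In a product of the `I_i^{c_i}` with `∑ c_i i = k ≥ a * a!`, one of the `a` terms has `c_i i ≥
a!`. As `i` divides `a!`, the factor `I_i^q` with `q = a! / i` can be split off, and it lies in
`I_{a,a!}`. -/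
theorem truncIdeal_le_mul_of_factorial {a k : ℕ} (ha : 0 < a) (hk : a * a.factorial ≤ k) :
    I.truncIdeal a k ≤ I.truncIdeal a a.factorial * I.truncIdeal a (k - a.factorial) := by
  refine (I.truncIdeal_le_iSup_prod a k).trans (iSup_le fun c => iSup_le fun hc => ?_)
  obtain ⟨i, hi, hle⟩ : ∃ i ∈ Finset.Icc 1 a, a.factorial ≤ c i * i := by
    refine Finset.exists_le_of_sum_le (Finset.nonempty_Icc.mpr ha) ?_
    rw [hc]
    simpa using hk
  obtain ⟨hi1, hia⟩ := Finset.mem_Icc.mp hi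
  obtain ⟨q, hq⟩ : i ∣ a.factorial := Nat.dvd_factorial hi1 hia
  have hqc : q ≤ c i := by
    rw [hq, mul_comm] at hle
    exact Nat.le_of_mul_le_mul_right hle hi1
  let c' : ℕ → ℕ := Function.update c i (c i - q)
  have hci : c' i = c i - q := Function.update_self ..
  have hcj : ∀ j ∈ (Finset.Icc 1 a).erase i, c' j = c j := fun j hj =>
    Function.update_of_ne (Finset.ne_of_mem_erase hj) ..
  have hsum : ∑ j ∈ Finset.Icc 1 a, c' j * j = k - a.factorial := by
    have h1 : ∑ j ∈ Finset.Icc 1 a, c' j * j + a.factorial = k := by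
      rw [← hc, ← Finset.add_sum_erase _ _ hi, ← Finset.add_sum_erase _ (fun j => c j * j) hi,
        Finset.sum_congr rfl (g := fun j => c j * j) fun j hj => by
          rw [hcj j hj]]
      rw [hci, hq, add_right_comm, mul_comm i q, ← add_mul, Nat.sub_add_cancel hqc]
    omega
  have hprod : ∏ j ∈ Finset.Icc 1 a, I.truncIdeal a j ^ c j =
      I.truncIdeal a i ^ q * ∏ j ∈ Finset.Icc 1 a, I.truncIdeal a j ^ c' j := by
    rw [← Finset.mul_prod_erase _ _ hi, ← Finset.mul_prod_erase _ (fun j => _ ^ c' j) hi,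
      Finset.prod_congr rfl (g := fun j => I.truncIdeal a j ^ c' j) fun j hj => by
        rw [hcj j hj],
      ← mul_assoc, ← pow_add, hci, Nat.add_sub_cancel' hqc]
  rw [hprod]
  refine Ideal.mul_mono ?_ ?_
  · rw [hq, mul_comm i q]
    exact (I.truncation a).pow_le_ideal i q
  · rw [← hsum]
    exact (I.truncation a).prod_pow_ideal_le _ c'

theorem truncIdeal_le_pow_mul_of_factorial {a k : ℕ} (ha : 0 < a) (hk : a * a.factorial ≤ k)
    (j : ℕ) : I.truncIdeal a (k + j * a.factorial) ≤
      I.truncIdeal a a.factorial ^ j * I.truncIdeal a k := by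
  induction j with
  | zero => simp
  | succ j ih =>
    refine (I.truncIdeal_le_mul_of_factorial ha (by omega)).trans ?_
    rw [Nat.succ_mul, ← add_assoc, Nat.add_sub_cancel, pow_succ', mul_assoc]
    exact Ideal.mul_mono le_rfl ih

/-- From degree `(r + 1) * (a * a!)` one splits off `a` factors of degree `a!`; their product lies
in degree `a * a!`, and the remaining degree is `r * (a * a!)`. -/
theorem truncIdeal_mul_le_pow {a : ℕ} (ha : 0 < a) (r : ℕ) :
    I.truncIdeal a (r * (a * a.factorial)) ≤ I.truncIdeal a (a * a.factorial) ^ r := by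
  induction r with
  | zero => simp
  | succ r ih =>
    -- For `r = 0` the remaining degree is below the threshold `a * a!`, but the claim is trivial.
    rcases Nat.eq_zero_or_pos r with rfl | hr
    · simp
    rw [Nat.succ_mul, pow_succ']
    refine (I.truncIdeal_le_pow_mul_of_factorial ha (Nat.le_mul_of_pos_left _ hr) a).trans ?_
    exact Ideal.mul_mono ((I.truncation a).pow_le_ideal _ a) ih

variable {I} in
/-- If `I_{re} ⊆ (I_e)^r` for all `r`, then the `e`-th Veronese subalgebra is standard graded. -/
theorem veroneseIsStandard_of_le_pow {e : ℕ} (h : ∀ r, I.ideal (r * e) ≤ I.ideal e ^ r) :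
    I.VeroneseIsStandard e := by
  have hmem : ∀ r, ∀ x ∈ I.ideal e ^ r,
      monomial (r * e) x ∈ Algebra.adjoin R {f : R[X] | ∃ x ∈ I.ideal e, f = monomial e x} := by
    intro r
    induction r with
    | zero =>
      intro x _
      rw [Nat.zero_mul]
      exact Subalgebra.algebraMap_mem _ x
    | succ r ih =>
      intro x hx
      rw [pow_succ] at hx
      induction hx using Submodule.mul_induction_on' with
      | mem_mul_mem y hy z hz =>
        rw [Nat.succ_mul, ← monomial_mul_monomial]
        exact mul_mem (ih y hy) (Algebra.subset_adjoin ⟨z, hz, rfl⟩)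
      | add y _ z _ hy hz =>
        rw [map_add]
        exact add_mem hy hz
  refine le_antisymm (Algebra.adjoin_le ?_) fun f hf => ?_
  · rintro _ ⟨x, hx, rfl⟩
    refine ⟨monomial_mem_reesAlg hx, fun i hi => ?_⟩
    rw [coeff_monomial, if_neg]
    rintro rfl
    exact hi dvd_rfl
  · rw [as_sum_support f]
    refine sum_mem fun i hi => ?_
    obtain ⟨r, rfl⟩ : e ∣ i := by
      by_contra h'
      exact mem_support_iff.mp hi (hf.2 i h')
    rw [mul_comm e r]
    exact hmem r _ (h r (hf.1 _))

/-- The truncation of a graded family has a standard graded Veronese subalgebra. -/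
theorem exists_isTruncExponent {a : ℕ} (ha : 0 < a) : ∃ e, I.IsTruncExponent a e :=
  ⟨a * a.factorial, Nat.mul_pos ha a.factorial_pos,
    veroneseIsStandard_of_le_pow (I.truncIdeal_mul_le_pow ha)⟩

end TruncationExponent

end GradedFamily

/-! ### Existence of the maxima and the main theorem -/

theorem WithBot.exists_natCast_eq_of_nonneg_of_le {x : WithBot ℕ∞} {n : ℕ} (h0 : 0 ≤ x)
    (hn : x ≤ n) : ∃ d : ℕ, x = d ∧ d ≤ n := by
  cases x with
  | bot => exact absurd h0 (by simp)
  | coe x =>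
    cases x with
    | top => exact absurd (WithBot.coe_le_coe.mp hn) (by simp)
    | coe d => exact ⟨d, rfl, by exact_mod_cast hn⟩

/-- A nonempty family of values in `{0, …, n} ⊆ WithBot ℕ∞` has a maximum. -/
theorem exists_isGreatest_range_of_nonneg_of_le {ι : Type*} [Nonempty ι] {f : ι → WithBot ℕ∞}
    {n : ℕ} (h0 : ∀ i, 0 ≤ f i) (hn : ∀ i, f i ≤ n) : ∃ M, IsGreatest (Set.range f) M := by
  have hfin : (Set.range f).Finite := by
    refine ((Set.finite_Iic n).image fun d : ℕ => (d : WithBot ℕ∞)).subset ?_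
    rintro _ ⟨i, rfl⟩
    obtain ⟨d, hd, hdn⟩ := WithBot.exists_natCast_eq_of_nonneg_of_le (h0 i) (hn i)
    exact ⟨d, hdn, hd.symm⟩
  obtain ⟨M, hM, hmax⟩ := hfin.exists_maximal (Set.range_nonempty f)
  exact ⟨M, hM, fun x hx => (le_total x M).elim id fun h => hmax hx h⟩

theorem proposition4p8 {K : Type*} [Field K] {n : ℕ} (hn : 0 < n)
    (I : GradedFamily (MvPolynomial (Fin n) K))
    (hI : I.IsHomogeneous) :
    -- admissible exponents `e_a` exist, so that the upper truncations are defined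
    (∀ a : ℕ+, ∃ e : ℕ, I.IsTruncExponent a e) ∧
    -- for every choice of the `e_a`, both maxima exist, coincide, and bound the analytic spread
    (∀ (e : ℕ+ → ℕ) (he : ∀ a : ℕ+, I.IsTruncExponent a (e a)),
      ∃ M : WithBot ℕ∞,
        IsGreatest (Set.range fun a : ℕ+ =>
          (I.upperTruncation a (e a) (he a)).analyticSpread (MvPolynomial.idealOfVars (Fin n) K)) M ∧
        IsGreatest (Set.range fun a : ℕ+ =>
          (GradedFamily.powers (I.ideal (e a))).analyticSpread
            (MvPolynomial.idealOfVars (Fin n) K)) M ∧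
        I.analyticSpread (MvPolynomial.idealOfVars (Fin n) K) ≤ M) ∧
    I.analyticSpread (MvPolynomial.idealOfVars (Fin n) K) ≤
      ringKrullDim (MvPolynomial (Fin n) K) ∧
    (∃ d : ℕ, I.analyticSpread (MvPolynomial.idealOfVars (Fin n) K) = d) := by
  set m := MvPolynomial.idealOfVars (Fin n) K
  have hm : m ≠ ⊤ := GradedFamily.idealOfVars_ne_top
  have hle : ∀ J : GradedFamily (MvPolynomial (Fin n) K), J.analyticSpread m ≤ n :=
    GradedFamily.analyticSpread_le hn
  have hnonneg : ∀ J : GradedFamily (MvPolynomial (Fin n) K), 0 ≤ J.analyticSpread m := by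
    intro J
    have := J.nontrivial_fiber hm
    rw [J.analyticSpread_eq_ringKrullDim_fiber]
    exact ringKrullDim_nonneg_of_nontrivial
  obtain ⟨d, hd, -⟩ := WithBot.exists_natCast_eq_of_nonneg_of_le (hnonneg I) (hle I)
  refine ⟨fun a => I.exists_isTruncExponent a.pos, fun e he => ?_, ?_, d, hd⟩
  · obtain ⟨M, hM⟩ := exists_isGreatest_range_of_nonneg_of_le
      (f := fun a : ℕ+ => (GradedFamily.powers (I.ideal (e a))).analyticSpread m)
      (fun a => hnonneg _) (fun a => hle _)
    refine ⟨M, ?_, hM, ?_⟩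
    · simpa only [I.analyticSpread_upperTruncation m] using hM
    -- The analytic spread of `I` is already known to be the natural number `d`, so a single `a`
    -- realizes the bound.
    · obtain ⟨a, ha⟩ := I.exists_le_analyticSpread_powers (K := K) hm e he hd.ge
      exact hd.trans_le (ha.trans (hM.2 ⟨a, rfl⟩))
  · refine (hle I).trans_eq ?_
    simp
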